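/- Let $SU(2)$ be the group of matrices $h(\alpha,\beta)=\begin{pmatrix}\alpha&-\bar\beta\\ \beta&\bar\alpha\end{pmatrix}$, $|\alpha|^2+|\beta|^2=1$, with the Riemannian metric induced by $\langle A,B\rangle=2\,\mathrm{Re}\,\mathrm{tr}(\bar A^{T}B)$, i.e. the round metric of a sphere of radius $2$. Put $$g_1(t)=\begin{pmatrix}\cos\frac t2&i\sin\frac t2\\ i\sin\frac t2&\cos\frac t2\end{pmatrix},\quad g_2(t)=\begin{pmatrix}\cos\frac t2&-\sin\frac t2\\ \sin\frac t2&\cos\frac t2\end{pmatrix},\quad g_3(t)=\begin{pmatrix}e^{it/2}&0\\0&e^{-it/2}\end{pmatrix},$$ and let $X_aF(g)=\frac{d}{dt}\big|_{t=0}F(g\,g_a(t))$ for $a=1,2,3$. On smooth functions $F:SU(2)\to\mathbb C$ let $\Delta_{SU(2)}$ be the Laplace–Beltrami operator, let $\frac{d}{d\psi}=X_3$, and let $\frac{d^2}{d\psi^2}F(g)=\frac{d^2}{d\psi^2}\big|_{\psi=0}F(g\,g_3(\psi))$ be the vertical Laplacian of the Hopf fibration $SU(2)\to S^2$. Let $\Delta_h=\Delta_{SU(2)}-\frac{d^2}{d\psi^2}$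 be its horizontal Laplacian. For $n\in\frac12\mathbb Z$ let $\mathcal R(n)$ be the space of smooth $F$ with $F(g\,g_3(\psi))=F(g)e^{in\psi}$ for all $g$ and $\psi$ (right spin $n$), and let $$\eth=-(X_2+iX_1),\qquad \overline\eth=-(X_2-iX_1),\qquad Q=-i\frac{d}{d\psi}.$$ Then: 1. $\eth,\overline\eth,Q,\frac{d^2}{d\psi^2},\Delta_{SU(2)}$ map smooth functions to smooth functions, and $\eth$ maps $\mathcal R(n)$ to $\mathcal R(n+1)$ while $\overline\eth$ maps $\mathcal R(n)$ to $\mathcal R(n-1)$, for every $n\in\frac12\mathbb Z$. 2. $Q$ is a (signed) square root of $-\frac{d^2}{d\psi^2}$: $Q^2=-\frac{d^2}{d\psi^2}$ on smooth functions, and $QF=nF$ for every $F\in\mathcal R(n)$. 3. On all smooth functions on $SU(2)$, $$\Delta_{SU(2)}=\eth\,\overline\eth+\frac{d^2}{d\psi^2}+Q,\qquad\text{equivalently}\qquad \Delta_h=\eth\,\overline\eth+Q.$$ 4. For $\ell\in\frac12\mathbb N$ and $m,s\in\{-\ell,-\ell+1,\dots,\ell\}$ let $\psi^\ell_m(z_0,z_1)=\binom{2\ell}{\ell+m}^{1/2}z_0^{\ell+m}z_1^{\ell-m}$,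 and let the Wigner functions $D^\ell_{m,s}$ be defined by $$\sum_{m=-\ell}^{\ell}\psi^\ell_m(z_0,z_1)\,D^\ell_{m,s}(h(\alpha,\beta))=\psi^\ell_s(\bar\alpha z_0+\bar\beta z_1,\,-\beta z_0+\alpha z_1).$$ Every $F\in\mathrm{span}_{\mathbb C}\{D^\ell_{m,s}: m=-\ell,\dots,\ell\}$ belongs to $\mathcal R(-s)$ and satisfies $$\Delta_{SU(2)}F=-\ell(\ell+1)F,\qquad \frac{d^2}{d\psi^2}F=-s^2F,\qquad \Delta_hF=\big(-(\ell-s)(\ell+s+1)-s\big)F,$$ $$\eth\,\overline\eth F=-(\ell-s)(\ell+s+1)F,\qquad QF=-sF.$$ -/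

import Mathlib

open Complex
open scoped ContDiff

noncomputable section

/-- The group `SU(2)`. -/
abbrev SU2 : Type := Matrix.specialUnitaryGroup (Fin 2) ℂ

/-- The matrix `h(a, b)` with first column `(a, b)`; these matrices form the quaternions `ℍ`. -/
def hMat (a b : ℂ) : Matrix (Fin 2) (Fin 2) ℂ :=
  !![a, -(starRingEnd ℂ b); b, starRingEnd ℂ a]

theorem hMat_mem {a b : ℂ} (h : Complex.normSq a + Complex.normSq b = 1) :
    hMat a b ∈ Matrix.specialUnitaryGroup (Fin 2) ℂ := by
  have h' : a * starRingEnd ℂ a + b * starRingEnd ℂ b = 1 := by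
    rw [Complex.mul_conj, Complex.mul_conj]; exact_mod_cast h
  rw [Matrix.mem_specialUnitaryGroup_iff, Matrix.mem_unitaryGroup_iff']
  constructor
  · ext i j
    fin_cases i <;> fin_cases j <;>
      simp [hMat, Matrix.mul_apply, Fin.sum_univ_two, Matrix.star_apply] <;>
      first | linear_combination h' | ring
  · simp [hMat, Matrix.det_fin_two]
    linear_combination h'

/-- The element `h(a, b)` of `SU(2)`, for `|a|² + |b|² = 1`. -/
def hSU2 (a b : ℂ) (h : Complex.normSq a + Complex.normSq b = 1) : SU2 := ⟨hMat a b, hMat_mem h⟩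

/-! ### One-parameter subgroups -/

/-- `g₁(t) = exp (t i σ₁ / 2)`. -/
def gOne (t : ℝ) : SU2 :=
  hSU2 (Real.cos (t / 2) : ℝ) ((Real.sin (t / 2) : ℝ) * I) (by
    simp only [Complex.normSq_mul, Complex.normSq_ofReal, Complex.normSq_I]
    nlinarith [Real.sin_sq_add_cos_sq (t / 2)])

/-- `g₂(t)`, the matrix with rows `(cos (t/2), -sin (t/2))` and `(sin (t/2), cos (t/2))`. -/
def gTwo (t : ℝ) : SU2 :=
  hSU2 (Real.cos (t / 2) : ℝ) (Real.sin (t / 2) : ℝ) (by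
    simp only [Complex.normSq_ofReal]
    nlinarith [Real.sin_sq_add_cos_sq (t / 2)])

/-- `g₃(t) = diag (exp (i t / 2), exp (-i t / 2))`. -/
def gThree (t : ℝ) : SU2 :=
  hSU2 (Complex.exp ((t / 2 : ℝ) * I)) 0 (by
    rw [Complex.normSq_eq_norm_sq, Complex.norm_exp_ofReal_mul_I]; simp)

/-! ### Smooth functions and functions of pure right spin -/

/-- `F ∈ C^∞(SU(2))`: `F` is the restriction of a smooth function on `ℂ² = ℝ⁴`, where
`SU(2)` is the unit sphere of `ℂ²` through `h(a, b) ↦ (a, b)`. -/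
def IsSmoothSU2 (F : SU2 → ℂ) : Prop :=
  ∃ f : ℂ × ℂ → ℂ, ContDiff ℝ ∞ f ∧ ∀ g : SU2, F g = f (g.1 0 0, g.1 1 0)

/-- `R(n)` for the half-integer `n = k / 2`: the smooth functions of right spin `n`. -/
def rightSpin (k : ℤ) : Set (SU2 → ℂ) :=
  {F | IsSmoothSU2 F ∧ ∀ (g : SU2) (ψ : ℝ),
    F (g * gThree ψ) = F g * Complex.exp (I * ((k : ℂ) / 2) * ψ)}

/-! ### The Laplace–Beltrami operator of the metric of the sphere of radius `2` -/

/-- The scalar product `⟨h₁, h₂⟩ = 2 Re tr (h₁* h₂)` on `2 × 2` matrices. On the quaternions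
`h(a, b)` it is `4` times the Euclidean one of `ℂ² = ℝ⁴`, so that `SU(2)` is the
sphere of radius `2`. -/
def metricH (A B : Matrix (Fin 2) (Fin 2) ℂ) : ℝ := 2 * (A.conjTranspose * B).trace.re

/-- The `i`-th coordinate tangent vector of a local parametrization of `SU(2)`. -/
def coordVec (x : (Fin 3 → ℝ) → SU2) (i : Fin 3) (u : Fin 3 → ℝ) : Matrix (Fin 2) (Fin 2) ℂ :=
  Matrix.of fun p q => lineDeriv ℝ (fun w => (x w).1 p q) u (Pi.single i 1)

/-- The matrix `(g_{ij})` of the Riemannian metric in local coordinates. -/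
def gram (x : (Fin 3 → ℝ) → SU2) (u : Fin 3 → ℝ) : Matrix (Fin 3) (Fin 3) ℝ :=
  Matrix.of fun i j => metricH (coordVec x i u) (coordVec x j u)

/-- The Laplace–Beltrami operator in local coordinates,
`(det g)^{-1/2} ∑ᵢⱼ ∂ᵢ ((det g)^{1/2} g^{ij} ∂ⱼ F)`. -/
def coordLaplacian (x : (Fin 3 → ℝ) → SU2) (F : SU2 → ℂ) (u : Fin 3 → ℝ) : ℂ :=
  (((Real.sqrt (gram x u).det)⁻¹ : ℝ) : ℂ) * ∑ i : Fin 3, ∑ j : Fin 3,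
    lineDeriv ℝ (fun w => ((Real.sqrt (gram x w).det * (gram x w)⁻¹ i j : ℝ) : ℂ) *
      lineDeriv ℝ (fun v => F (x v)) w (Pi.single j 1)) u (Pi.single i 1)

/-- `|u|² / 16`. -/
def stereoRho (u : Fin 3 → ℝ) : ℝ := (u 0 ^ 2 + u 1 ^ 2 + u 2 ^ 2) / 16

/-- The inverse stereographic projection, centred at `p`: a parametrization by `ℝ³` of
`SU(2)` without the antipode of `p`. -/
def stereo (p : SU2) (u : Fin 3 → ℝ) : SU2 :=
  p * hSU2 ⟨(1 - stereoRho u) / (1 + stereoRho u), u 0 / 2 / (1 + stereoRho u)⟩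
    ⟨u 1 / 2 / (1 + stereoRho u), u 2 / 2 / (1 + stereoRho u)⟩ (by
      have h : (1 + stereoRho u) ≠ 0 := by unfold stereoRho; positivity
      simp only [Complex.normSq_mk]
      field_simp
      unfold stereoRho
      ring)

/-- `Δ_{SU(2)}`, the Laplace–Beltrami operator of `SU(2)` as the sphere of radius `2`, computed
at each point in stereographic coordinates around that point. -/
def laplaceBeltrami (F : SU2 → ℂ) (p : SU2) : ℂ := coordLaplacian (stereo p) F 0

/-! ### The vertical and the horizontal Laplacian of the Hopf fibration -/

/-- The vertical Laplacian `d²/dψ²`. -/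
def vertLaplacian (F : SU2 → ℂ) (g : SU2) : ℂ :=
  iteratedDeriv 2 (fun ψ : ℝ => F (g * gThree ψ)) 0

/-- The horizontal Laplacian. -/
def horLaplacian (F : SU2 → ℂ) (g : SU2) : ℂ := laplaceBeltrami F g - vertLaplacian F g

/-- The operator `-i d/dψ`. -/
def spinOp (F : SU2 → ℂ) (g : SU2) : ℂ := -I * deriv (fun ψ : ℝ => F (g * gThree ψ)) 0

/-! ### The spin raising and the spin lowering operator -/

/-- The spin raising operator, `ð = -(X₂ + i X₁)` with `X_a F (g) = d/dt|₀ F (g g_a(t))`. On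
functions of right spin `n`, in Euler angles `g₃(φ) g₂(θ) g₃(ψ)` and at `ψ = 0`, it is
`-(sin θ)^n (∂_θ - (i / sin θ) ∂_φ) (sin θ)^{-n}`. -/
def eth (F : SU2 → ℂ) (g : SU2) : ℂ :=
  -(deriv (fun t : ℝ => F (g * gTwo t)) 0 + I * deriv (fun t : ℝ => F (g * gOne t)) 0)

/-- The spin lowering operator, `-(X₂ - i X₁)`. -/
def ethBar (F : SU2 → ℂ) (g : SU2) : ℂ :=
  -(deriv (fun t : ℝ => F (g * gTwo t)) 0 - I * deriv (fun t : ℝ => F (g * gOne t)) 0)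

/-! ### The Wigner functions -/

/-- The rescaled monomial `ψ^ℓ_m (z₀, z₁)`, with `N = 2ℓ` and `j = ℓ + m`. -/
def wignerMonomial (N j : ℕ) (z₀ z₁ : ℂ) : ℂ :=
  (Real.sqrt (N.choose j) : ℝ) * z₀ ^ j * z₁ ^ (N - j)

/-- The Wigner function `D^ℓ_{m,s}`, with `N = 2ℓ`, `j = ℓ + m` and `k = ℓ + s`: the coefficient
of `ψ^ℓ_m (z)` in `ψ^ℓ_s (g⁻¹ z)`, where `g = h(a, b)` and
`g⁻¹ z = (conj a * z₀ + conj b * z₁, -b * z₀ + a * z₁)`. -/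
def wignerD (N j k : ℕ) (g : SU2) : ℂ :=
  (Real.sqrt (N.choose k) : ℝ) / (Real.sqrt (N.choose j) : ℝ) *
    ((Polynomial.C (starRingEnd ℂ (g.1 0 0)) * Polynomial.X +
        Polynomial.C (starRingEnd ℂ (g.1 1 0))) ^ k *
      (Polynomial.C (-(g.1 1 0)) * Polynomial.X + Polynomial.C (g.1 0 0)) ^ (N - k)).coeff j

theorem sum_coeff_homogeneous (N k : ℕ) (hk : k ≤ N) (a b c d z₀ z₁ : ℂ) :
    ∑ j ∈ Finset.range (N + 1),
      ((Polynomial.C a * Polynomial.X + Polynomial.C b) ^ k *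
        (Polynomial.C c * Polynomial.X + Polynomial.C d) ^ (N - k)).coeff j *
          (z₀ ^ j * z₁ ^ (N - j)) =
      (a * z₀ + b * z₁) ^ k * (c * z₀ + d * z₁) ^ (N - k) := by
  set p := (Polynomial.C a * Polynomial.X + Polynomial.C b) ^ k with hp
  set q := (Polynomial.C c * Polynomial.X + Polynomial.C d) ^ (N - k) with hq
  have dp : p.natDegree ≤ k := by
    have := Polynomial.natDegree_pow_le_of_le k
      (Polynomial.natDegree_linear_le (a := a) (b := b))
    rwa [mul_one] at this
  have dq : q.natDegree ≤ N - k := by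
    have := Polynomial.natDegree_pow_le_of_le (N - k)
      (Polynomial.natDegree_linear_le (a := c) (b := d))
    rwa [mul_one] at this
  have dpq : (p * q).natDegree < N + 1 := by
    have := Polynomial.natDegree_mul_le_of_le dp dq
    omega
  by_cases hz : z₁ = 0
  · subst hz
    rw [Finset.sum_range_succ, Finset.sum_eq_zero]
    · have h1 : (p * q).coeff (k + (N - k)) = p.coeff k * q.coeff (N - k) :=
        Polynomial.coeff_mul_add_eq_of_natDegree_le dp dq
      have h2 : p.coeff k = a ^ k := by
        have := Polynomial.coeff_pow_of_natDegree_le (m := k)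
          (Polynomial.natDegree_linear_le (a := a) (b := b))
        simpa using this
      have h3 : q.coeff (N - k) = c ^ (N - k) := by
        have := Polynomial.coeff_pow_of_natDegree_le (m := N - k)
          (Polynomial.natDegree_linear_le (a := c) (b := d))
        simpa using this
      have h4 : k + (N - k) = N := by omega
      rw [h4] at h1
      rw [h1, h2, h3]
      simp only [mul_zero, add_zero, mul_pow, Nat.sub_self, pow_zero, mul_one, zero_add]
      have h5 : z₀ ^ N = z₀ ^ k * z₀ ^ (N - k) := by rw [← pow_add, h4]
      rw [h5]
      ring
    · intro j hj
      have : N - j ≠ 0 := by have := Finset.mem_range.1 hj; omega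
      simp [this]
  · have key : ∀ j ∈ Finset.range (N + 1), (p * q).coeff j * (z₀ ^ j * z₁ ^ (N - j)) =
        z₁ ^ N * ((p * q).coeff j * (z₀ / z₁) ^ j) := by
      intro j hj
      have hj' : j ≤ N := by have := Finset.mem_range.1 hj; omega
      have : z₁ ^ N = z₁ ^ (N - j) * z₁ ^ j := by rw [← pow_add]; congr 1; omega
      rw [this, div_pow]
      field_simp
    rw [Finset.sum_congr rfl key, ← Finset.mul_sum, ← Polynomial.eval_eq_sum_range' dpq]
    have hN : z₁ ^ N = z₁ ^ k * z₁ ^ (N - k) := by rw [← pow_add]; congr 1; omega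
    simp only [hp, hq, Polynomial.eval_mul, Polynomial.eval_pow, Polynomial.eval_add,
      Polynomial.eval_C, Polynomial.eval_X]
    rw [hN, mul_mul_mul_comm, ← mul_pow, ← mul_pow]
    congr 2 <;> field_simp

/-- The defining identity `∑_m ψ^ℓ_m (z) D^ℓ_{m,s} (g) = ψ^ℓ_s (g⁻¹ z)`. -/
theorem wignerD_generating (N k : ℕ) (hk : k ≤ N) (g : SU2) (z₀ z₁ : ℂ) :
    ∑ j ∈ Finset.range (N + 1), wignerMonomial N j z₀ z₁ * wignerD N j k g =
      wignerMonomial N k (starRingEnd ℂ (g.1 0 0) * z₀ + starRingEnd ℂ (g.1 1 0) * z₁)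
        (-(g.1 1 0) * z₀ + g.1 0 0 * z₁) := by
  unfold wignerMonomial wignerD
  rw [mul_assoc, ← sum_coeff_homogeneous N k hk, Finset.mul_sum]
  refine Finset.sum_congr rfl fun j hj => ?_
  have hj' : j ≤ N := by have := Finset.mem_range.1 hj; omega
  have h0 : ((Real.sqrt (N.choose j) : ℝ) : ℂ) ≠ 0 := by
    have : (0 : ℝ) < N.choose j := by exact_mod_cast Nat.choose_pos hj'
    exact_mod_cast (Real.sqrt_pos.2 this).ne'
  field_simp

/-- The space of column coefficients `span {D^ℓ_{m,s} : m = -ℓ, …, ℓ}`, with `N = 2ℓ` and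
`k = ℓ + s`. -/
def wignerColumn (N k : ℕ) : Submodule ℂ (SU2 → ℂ) :=
  Submodule.span ℂ {F | ∃ j : ℕ, j ≤ N ∧ F = wignerD N j k}

end

/-! An element of `SU(2)` is determined by its first column, a unit vector of `ℂ²`, and right
multiplication becomes the real-linear map `rightMul`. Hence each `X_a` is the restriction of a
linear vector field on all of `ℂ²`, smoothness is preserved, and commutators reduce to quaternion
brackets: `X₁X₂ - X₂X₁ = X₃` (`rightDeriv_gOne_gTwo_comm`). Expanding, `ð ð̄ = (X₂ + iX₁)(X₂ - iX₁)
= X₁² + X₂² + iX₃`, and `Q = -iX₃` cancels the last term.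

The decomposition then amounts to `Δ = X₁² + X₂² + X₃²` (`laplaceBeltrami_eq`). Stereographic
coordinates at `p` are conformal, so only the diagonal second-order terms survive. The coordinate
axes are the curves `p g_a(t)` reparametrized, and the conformal factor is stationary at the centre,
so the three terms are the `X_a²`.

Conjugation by `g₃(ψ)` rotates the plane of `X₁, X₂`, and `X₂ ± iX₁` are its eigenvectors with
eigenvalues `exp (±iψ)`; this is the shift of the right spin.

For the Wigner functions put `u = ā X + b̄` and `v = -b X + a`. On coefficients of `u^k v^m`, `ð`
turns `u` into `-v` and `ð̄` turns `v` into `u`, as derivations. So `ð ð̄` has eigenvalue `-m(k+1)`,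
where `k = ℓ+s` and `m = ℓ-s`, and the phase under `g₃` gives the right spin `-s`. The remaining
eigenvalues follow from the decomposition. -/

/-! ### `SU(2)` as the unit sphere of `ℂ²`. -/

/-- The first column of an element of `SU(2)`. -/
def firstCol (g : SU2) : ℂ × ℂ := (g.1 0 0, g.1 1 0)

/-- Right multiplication by the quaternion with first column `v`, on first columns. -/
noncomputable def rightMul (v : ℂ × ℂ) : ℂ × ℂ →L[ℝ] ℂ × ℂ :=
  LinearMap.toContinuousLinearMap
    { toFun := fun p => (p.1 * v.1 - starRingEnd ℂ p.2 * v.2, p.2 * v.1 + starRingEnd ℂ p.1 * v.2)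
      map_add' := fun p q => by ext <;> simp <;> ring
      map_smul' := fun c p => by ext <;> simp <;> ring }

theorem rightMul_apply (v p : ℂ × ℂ) : rightMul v p =
    (p.1 * v.1 - starRingEnd ℂ p.2 * v.2, p.2 * v.1 + starRingEnd ℂ p.1 * v.2) := rfl

/-- Unitarity says that `g*` is the inverse, determinant one says that the adjugate is; comparing
entries expresses the second column through the first. -/
theorem SU2.apply_zero_one (g : SU2) : g.1 0 1 = -starRingEnd ℂ (g.1 1 0) := by
  have h := (Matrix.mem_specialUnitaryGroup_iff.1 g.2)
  have hu := Matrix.mem_unitaryGroup_iff.1 h.1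
  have hd := h.2
  rw [Matrix.det_fin_two] at hd
  have e1 : g.1 0 0 * star (g.1 0 0) + g.1 0 1 * star (g.1 0 1) = 1 := by
    simpa [Matrix.mul_apply, Fin.sum_univ_two] using congrFun (congrFun hu 0) 0
  have e2 : g.1 1 0 * star (g.1 0 0) + g.1 1 1 * star (g.1 0 1) = 0 := by
    simpa [Matrix.mul_apply, Fin.sum_univ_two] using congrFun (congrFun hu 1) 0
  have : star (g.1 0 1) = -g.1 1 0 := by
    linear_combination (-g.1 1 0) * e1 + g.1 0 0 * e2 - star (g.1 0 1) * hd
  rw [← star_star (g.1 0 1), this]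
  simp

theorem SU2.apply_one_one (g : SU2) : g.1 1 1 = starRingEnd ℂ (g.1 0 0) := by
  have h := (Matrix.mem_specialUnitaryGroup_iff.1 g.2)
  have hu := Matrix.mem_unitaryGroup_iff.1 h.1
  have hd := h.2
  rw [Matrix.det_fin_two] at hd
  have e1 : g.1 0 0 * star (g.1 0 0) + g.1 0 1 * star (g.1 0 1) = 1 := by
    simpa [Matrix.mul_apply, Fin.sum_univ_two] using congrFun (congrFun hu 0) 0
  have e2 : g.1 1 0 * star (g.1 0 0) + g.1 1 1 * star (g.1 0 1) = 0 := by
    simpa [Matrix.mul_apply, Fin.sum_univ_two] using congrFun (congrFun hu 1) 0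
  have : g.1 1 1 = star (g.1 0 0) := by
    linear_combination (-g.1 1 1) * e1 + g.1 0 1 * e2 + star (g.1 0 0) * hd
  simpa using this

theorem normSq_firstCol (g : SU2) : normSq (g.1 0 0) + normSq (g.1 1 0) = 1 := by
  have hd := (Matrix.mem_specialUnitaryGroup_iff.1 g.2).2
  rw [Matrix.det_fin_two, SU2.apply_zero_one, SU2.apply_one_one] at hd
  have : ((normSq (g.1 0 0) + normSq (g.1 1 0) : ℝ) : ℂ) = 1 := by
    push_cast
    rw [← Complex.mul_conj, ← Complex.mul_conj]
    linear_combination hd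
  exact_mod_cast this

theorem SU2.ext_firstCol {g h : SU2} (e : firstCol g = firstCol h) : g = h := by
  have e0 : g.1 0 0 = h.1 0 0 := congrArg Prod.fst e
  have e1 : g.1 1 0 = h.1 1 0 := congrArg Prod.snd e
  apply Subtype.ext
  ext i j
  fin_cases i <;> fin_cases j
  all_goals simp [e0, e1, SU2.apply_zero_one g, SU2.apply_zero_one h, SU2.apply_one_one g,
    SU2.apply_one_one h]

theorem firstCol_mul (g h : SU2) : firstCol (g * h) = rightMul (firstCol h) (firstCol g) := by
  ext <;> simp [firstCol, rightMul_apply, Matrix.mul_apply, Fin.sum_univ_two,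
    SU2.apply_zero_one g, SU2.apply_one_one g] <;> ring

theorem firstCol_hSU2 (a b : ℂ) (h) : firstCol (hSU2 a b h) = (a, b) := by
  simp [firstCol, hSU2, hMat]

/-! ### One-parameter subgroups. -/

/-- `γ` is a one-parameter subgroup of `SU(2)` whose velocity at `0` has first column `v`. -/
structure IsOneParam (γ : ℝ → SU2) (v : ℂ × ℂ) : Prop where
  map_zero : γ 0 = 1
  map_add : ∀ s t, γ (s + t) = γ s * γ t
  hasDerivAt : HasDerivAt (fun t => firstCol (γ t)) v 0

theorem hasDerivAt_cos_half : HasDerivAt (fun t : ℝ => ((Real.cos (t / 2) : ℝ) : ℂ)) 0 0 := by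
  have h := ((hasDerivAt_id (0 : ℝ)).div_const 2).cos.ofReal_comp
  simpa using h

theorem hasDerivAt_sin_half :
    HasDerivAt (fun t : ℝ => ((Real.sin (t / 2) : ℝ) : ℂ)) (1 / 2) 0 := by
  have h := ((hasDerivAt_id (0 : ℝ)).div_const 2).sin.ofReal_comp
  simpa using h

theorem isOneParam_gOne : IsOneParam gOne (0, I / 2) where
  map_zero := by
    apply SU2.ext_firstCol
    rw [gOne, firstCol_hSU2]
    simp [firstCol]
  map_add s t := by
    apply SU2.ext_firstCol
    simp only [firstCol_mul, gOne, firstCol_hSU2, rightMul_apply, add_div, Real.cos_add,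
      Real.sin_add]
    ext
    · simp [-ofReal_cos, -ofReal_sin]
      linear_combination
        -((Real.sin (s / 2) : ℝ) : ℂ) * (Real.sin (t / 2) : ℝ) * Complex.I_mul_I
    · simp [-ofReal_cos, -ofReal_sin]
      ring
  hasDerivAt := by
    simp only [gOne, firstCol_hSU2]
    convert hasDerivAt_cos_half.prodMk (hasDerivAt_sin_half.mul_const I) using 2
    ring

theorem isOneParam_gTwo : IsOneParam gTwo (0, 1 / 2) where
  map_zero := by
    apply SU2.ext_firstCol
    rw [gTwo, firstCol_hSU2]
    simp [firstCol]
  map_add s t := by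
    apply SU2.ext_firstCol
    simp only [firstCol_mul, gTwo, firstCol_hSU2, rightMul_apply, add_div, Real.cos_add,
      Real.sin_add]
    ext <;> simp [-ofReal_cos, -ofReal_sin]
  hasDerivAt := by
    simp only [gTwo, firstCol_hSU2]
    exact hasDerivAt_cos_half.prodMk hasDerivAt_sin_half

theorem isOneParam_gThree : IsOneParam gThree (I / 2, 0) where
  map_zero := by
    apply SU2.ext_firstCol
    rw [gThree, firstCol_hSU2]
    simp [firstCol]
  map_add s t := by
    apply SU2.ext_firstCol
    simp only [firstCol_mul, gThree, firstCol_hSU2, rightMul_apply]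
    ext
    · simp [add_div, add_mul, Complex.exp_add]
    · simp
  hasDerivAt := by
    simp only [gThree, firstCol_hSU2]
    have h := ((((hasDerivAt_id (0 : ℝ)).div_const 2).ofReal_comp.mul_const I).cexp).prodMk
      (hasDerivAt_const (0 : ℝ) (0 : ℂ))
    convert h using 2 <;> simp [div_eq_inv_mul]

/-! ### Left-invariant derivatives as linear vector fields. -/

/-- The derivative of `F` at `g` along `t ↦ g * γ t`. -/
noncomputable def rightDeriv (γ : ℝ → SU2) (F : SU2 → ℂ) (g : SU2) : ℂ :=
  deriv (fun t => F (g * γ t)) 0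

/-- The derivative of `f` along the linear vector field `p ↦ rightMul v p`. -/
noncomputable def fieldDeriv (v : ℂ × ℂ) (f : ℂ × ℂ → ℂ) (p : ℂ × ℂ) : ℂ :=
  fderiv ℝ f p (rightMul v p)

theorem contDiff_fieldDeriv {f : ℂ × ℂ → ℂ} (hf : ContDiff ℝ ∞ f) (v : ℂ × ℂ) :
    ContDiff ℝ ∞ (fieldDeriv v f) :=
  (hf.fderiv_right (m := ∞) (by simp)).clm_apply (rightMul v).contDiff

theorem hasDerivAt_rightMul {c : ℝ → ℂ × ℂ} {v : ℂ × ℂ} {t : ℝ} (hc : HasDerivAt c v t)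
    (p : ℂ × ℂ) : HasDerivAt (fun s => rightMul (c s) p) (rightMul v p) t := by
  have h1 : HasDerivAt (fun s => (c s).1) v.1 t :=
    (ContinuousLinearMap.fst ℝ ℂ ℂ).hasFDerivAt.comp_hasDerivAt t hc
  have h2 : HasDerivAt (fun s => (c s).2) v.2 t :=
    (ContinuousLinearMap.snd ℝ ℂ ℂ).hasFDerivAt.comp_hasDerivAt t hc
  exact ((h1.const_mul p.1).sub (h2.const_mul _)).prodMk ((h1.const_mul p.2).add (h2.const_mul _))

/-- The chain rule for an arbitrary curve in `SU(2)`, not only a subgroup: it is also needed for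
`g₃(ψ) γ(t) g₃(-ψ)`. -/
theorem hasDerivAt_comp_mul {F : SU2 → ℂ} {f : ℂ × ℂ → ℂ} (hf : ContDiff ℝ ∞ f)
    (hF : ∀ g, F g = f (firstCol g)) {γ : ℝ → SU2} {v : ℂ × ℂ} {t : ℝ}
    (hγ : HasDerivAt (fun t => firstCol (γ t)) v t) (g : SU2) :
    HasDerivAt (fun s => F (g * γ s)) (fderiv ℝ f (firstCol (g * γ t)) (rightMul v (firstCol g)))
      t := by
  have h1 := hasDerivAt_rightMul hγ (firstCol g)
  have h2 := (hf.differentiable (by simp) (firstCol (g * γ t))).hasFDerivAt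
  rw [firstCol_mul] at h2 ⊢
  have h3 := h2.comp_hasDerivAt t h1
  refine h3.congr_of_eventuallyEq (Filter.Eventually.of_forall fun s => ?_)
  simp only [Function.comp, hF, firstCol_mul]

theorem rightDeriv_eq {F : SU2 → ℂ} {f : ℂ × ℂ → ℂ} (hf : ContDiff ℝ ∞ f)
    (hF : ∀ g, F g = f (firstCol g)) {γ : ℝ → SU2} {v : ℂ × ℂ} (hγ : IsOneParam γ v) (g : SU2) :
    rightDeriv γ F g = fieldDeriv v f (firstCol g) := by
  have h := (hasDerivAt_comp_mul hf hF hγ.hasDerivAt g).deriv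
  rw [hγ.map_zero, mul_one] at h
  exact h

theorem IsSmoothSU2.rightDeriv {F : SU2 → ℂ} (hF : IsSmoothSU2 F) {γ : ℝ → SU2} {v : ℂ × ℂ}
    (hγ : IsOneParam γ v) : IsSmoothSU2 (rightDeriv γ F) := by
  obtain ⟨f, hf, hF⟩ := hF
  exact ⟨fieldDeriv v f, contDiff_fieldDeriv hf v, rightDeriv_eq hf hF hγ⟩

theorem IsSmoothSU2.add {F G : SU2 → ℂ} (hF : IsSmoothSU2 F) (hG : IsSmoothSU2 G) :
    IsSmoothSU2 (F + G) := by
  obtain ⟨f, hf, hF⟩ := hF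
  obtain ⟨f', hf', hG⟩ := hG
  exact ⟨f + f', hf.add hf', fun g => by simp [hF g, hG g]⟩

theorem IsSmoothSU2.smul {F : SU2 → ℂ} (hF : IsSmoothSU2 F) (c : ℂ) : IsSmoothSU2 (c • F) := by
  obtain ⟨f, hf, hF⟩ := hF
  exact ⟨c • f, contDiff_const.smul hf, fun g => by simp [hF g]⟩

theorem IsSmoothSU2.hasDerivAt {F : SU2 → ℂ} (hF : IsSmoothSU2 F) {γ : ℝ → SU2} {v : ℂ × ℂ}
    (hγ : IsOneParam γ v) (g : SU2) (t : ℝ) :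
    HasDerivAt (fun s => F (g * γ s)) (_root_.rightDeriv γ F (g * γ t)) t := by
  obtain ⟨f, hf, hF⟩ := hF
  -- Time `t` is moved to time `0` by `g γ(s) = (g γ(t)) γ(s - t)`.
  have h0 := (hasDerivAt_comp_mul hf hF hγ.hasDerivAt (g * γ t)).differentiableAt.hasDerivAt
  have h1 : HasDerivAt (fun s : ℝ => s - t) 1 t := (hasDerivAt_id t).sub_const t
  have h2 : HasDerivAt (fun s => F (g * γ t * γ s)) (_root_.rightDeriv γ F (g * γ t)) (t - t) := by
    rw [sub_self]; exact h0
  have h3 := HasDerivAt.scomp (h := fun s => s - t) t h2 h1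
  rw [one_smul] at h3
  refine h3.congr_of_eventuallyEq (Filter.Eventually.of_forall fun s => ?_)
  simp only [Function.comp, mul_assoc, ← hγ.map_add]
  congr 3
  ring

theorem IsSmoothSU2.hasDerivAt_zero {F : SU2 → ℂ} (hF : IsSmoothSU2 F) {γ : ℝ → SU2} {v : ℂ × ℂ}
    (hγ : IsOneParam γ v) (g : SU2) :
    HasDerivAt (fun s => F (g * γ s)) (_root_.rightDeriv γ F g) 0 := by
  have h := hF.hasDerivAt hγ g 0
  rwa [hγ.map_zero, mul_one] at h

theorem rightDeriv_add {F G : SU2 → ℂ} (hF : IsSmoothSU2 F) (hG : IsSmoothSU2 G)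
    {γ : ℝ → SU2} {v : ℂ × ℂ} (hγ : IsOneParam γ v) :
    rightDeriv γ (F + G) = rightDeriv γ F + rightDeriv γ G :=
  funext fun g => ((hF.hasDerivAt_zero hγ g).add (hG.hasDerivAt_zero hγ g)).deriv

theorem rightDeriv_smul {F : SU2 → ℂ} (hF : IsSmoothSU2 F) (c : ℂ)
    {γ : ℝ → SU2} {v : ℂ × ℂ} (hγ : IsOneParam γ v) :
    rightDeriv γ (c • F) = c • rightDeriv γ F :=
  funext fun g => ((hF.hasDerivAt_zero hγ g).const_smul c).deriv

/-- Separates the Hessian term, symmetric in `v` and `w`, from the first-order term, which alone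
contributes to a commutator. -/
theorem fieldDeriv_fieldDeriv {f : ℂ × ℂ → ℂ} (hf : ContDiff ℝ ∞ f) (v w p : ℂ × ℂ) :
    fieldDeriv v (fieldDeriv w f) p =
      fderiv ℝ (fderiv ℝ f) p (rightMul v p) (rightMul w p) +
        fderiv ℝ f p (rightMul w (rightMul v p)) := by
  have h1 : HasFDerivAt (fderiv ℝ f) (fderiv ℝ (fderiv ℝ f) p) p :=
    ((hf.fderiv_right (m := ∞) (by simp)).differentiable (by simp) p).hasFDerivAt
  have h2 := h1.clm_apply (rightMul w).hasFDerivAt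
  have h3 : fderiv ℝ (fieldDeriv w f) p = _ := h2.fderiv
  rw [fieldDeriv, h3]
  simp [add_comm]

theorem rightDeriv_gOne_gTwo_comm {F : SU2 → ℂ} (hF : IsSmoothSU2 F) (g : SU2) :
    rightDeriv gOne (rightDeriv gTwo F) g - rightDeriv gTwo (rightDeriv gOne F) g =
      rightDeriv gThree F g := by
  obtain ⟨f, hf, hF⟩ := hF
  have e1 := rightDeriv_eq hf hF isOneParam_gOne
  have e2 := rightDeriv_eq hf hF isOneParam_gTwo
  rw [rightDeriv_eq (contDiff_fieldDeriv hf _) e2 isOneParam_gOne,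
    rightDeriv_eq (contDiff_fieldDeriv hf _) e1 isOneParam_gTwo,
    rightDeriv_eq hf hF isOneParam_gThree, fieldDeriv_fieldDeriv hf, fieldDeriv_fieldDeriv hf]
  have hs : IsSymmSndFDerivAt ℝ f (firstCol g) :=
    (contDiff_infty.1 hf 2).contDiffAt.isSymmSndFDerivAt (by simp)
  rw [hs (rightMul (0, I / 2) (firstCol g)) (rightMul (0, 1 / 2) (firstCol g)),
    add_sub_add_left_eq_sub, ← map_sub, fieldDeriv]
  congr 1
  ext <;> simp [rightMul_apply, Complex.conj_ofNat] <;> ring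

/-! ### The operators `ð`, `ð̄`, `Q` and the vertical Laplacian. -/

theorem eth_eq (F : SU2 → ℂ) :
    eth F = (-1 : ℂ) • (rightDeriv gTwo F + I • rightDeriv gOne F) := by
  funext g; simp [eth, rightDeriv]

theorem ethBar_eq (F : SU2 → ℂ) :
    ethBar F = (-1 : ℂ) • (rightDeriv gTwo F + (-I) • rightDeriv gOne F) := by
  funext g; simp [ethBar, rightDeriv]; ring

theorem spinOp_eq (F : SU2 → ℂ) : spinOp F = (-I) • rightDeriv gThree F := rfl

theorem IsSmoothSU2.eth {F : SU2 → ℂ} (hF : IsSmoothSU2 F) : IsSmoothSU2 (eth F) := by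
  rw [eth_eq]
  exact ((hF.rightDeriv isOneParam_gTwo).add ((hF.rightDeriv isOneParam_gOne).smul I)).smul _

theorem IsSmoothSU2.ethBar {F : SU2 → ℂ} (hF : IsSmoothSU2 F) : IsSmoothSU2 (ethBar F) := by
  rw [ethBar_eq]
  exact ((hF.rightDeriv isOneParam_gTwo).add ((hF.rightDeriv isOneParam_gOne).smul _)).smul _

theorem IsSmoothSU2.spinOp {F : SU2 → ℂ} (hF : IsSmoothSU2 F) : IsSmoothSU2 (spinOp F) := by
  rw [spinOp_eq]
  exact (hF.rightDeriv isOneParam_gThree).smul _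

theorem iteratedDeriv_two_comp_mul {F : SU2 → ℂ} (hF : IsSmoothSU2 F) {γ : ℝ → SU2} {v : ℂ × ℂ}
    (hγ : IsOneParam γ v) (g : SU2) :
    iteratedDeriv 2 (fun t => F (g * γ t)) 0 = rightDeriv γ (rightDeriv γ F) g := by
  rw [iteratedDeriv_succ, iteratedDeriv_one,
    show deriv (fun t => F (g * γ t)) = fun t => rightDeriv γ F (g * γ t) from
      funext fun t => (hF.hasDerivAt hγ g t).deriv]
  rfl

theorem vertLaplacian_eq {F : SU2 → ℂ} (hF : IsSmoothSU2 F) :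
    vertLaplacian F = rightDeriv gThree (rightDeriv gThree F) :=
  funext fun g => iteratedDeriv_two_comp_mul hF isOneParam_gThree g

theorem spinOp_spinOp {F : SU2 → ℂ} (hF : IsSmoothSU2 F) (g : SU2) :
    spinOp (spinOp F) g = -vertLaplacian F g := by
  rw [spinOp_eq, spinOp_eq, rightDeriv_smul (hF.rightDeriv isOneParam_gThree) _ isOneParam_gThree,
    vertLaplacian_eq hF]
  simp only [Pi.smul_apply, smul_eq_mul]
  linear_combination rightDeriv gThree (rightDeriv gThree F) g * Complex.I_mul_I

/-- `ð ð̄ + Q = X₁² + X₂²`. -/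
theorem eth_ethBar_add_spinOp {F : SU2 → ℂ} (hF : IsSmoothSU2 F) (g : SU2) :
    eth (ethBar F) g + spinOp F g =
      rightDeriv gOne (rightDeriv gOne F) g + rightDeriv gTwo (rightDeriv gTwo F) g := by
  have s1 := hF.rightDeriv isOneParam_gOne
  have s2 := hF.rightDeriv isOneParam_gTwo
  have e : ∀ {γ v}, IsOneParam γ v → rightDeriv γ (ethBar F) =
      (-1 : ℂ) • (rightDeriv γ (rightDeriv gTwo F) + (-I) • rightDeriv γ (rightDeriv gOne F)) := by
    intro γ v hγ
    rw [ethBar_eq, rightDeriv_smul (s2.add (s1.smul _)) _ hγ, rightDeriv_add s2 (s1.smul _) hγ,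
      rightDeriv_smul s1 _ hγ]
  rw [eth_eq, e isOneParam_gOne, e isOneParam_gTwo, spinOp_eq]
  simp only [Pi.smul_apply, Pi.add_apply, smul_eq_mul]
  linear_combination I * rightDeriv_gOne_gTwo_comm hF g -
    rightDeriv gOne (rightDeriv gOne F) g * Complex.I_mul_I

theorem spinOp_of_mem_rightSpin {k : ℤ} {F : SU2 → ℂ} (hF : F ∈ rightSpin k) (g : SU2) :
    spinOp F g = ((k : ℂ) / 2) * F g := by
  have h : HasDerivAt (fun ψ : ℝ => F g * Complex.exp (I * ((k : ℂ) / 2) * ψ))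
      (F g * (I * ((k : ℂ) / 2))) 0 := by
    have h1 := (((hasDerivAt_id (0 : ℝ)).ofReal_comp.const_mul (I * ((k : ℂ) / 2))).cexp).const_mul
      (F g)
    simpa using h1
  rw [spinOp, show (fun ψ : ℝ => F (g * gThree ψ)) = _ from funext (hF.2 g), h.deriv]
  linear_combination (-(k : ℂ) / 2 * F g) * Complex.I_mul_I

/-! ### Raising and lowering the right spin. -/

/-- The coefficients are real because `f` is only real-differentiable; rotated velocities must
therefore be split with `cos` and `sin`. -/
theorem fieldDeriv_combination (x y : ℝ) (v w : ℂ × ℂ) (f : ℂ × ℂ → ℂ) (p : ℂ × ℂ) :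
    fieldDeriv (x • v + y • w) f p = x * fieldDeriv v f p + y * fieldDeriv w f p := by
  have : rightMul (x • v + y • w) p = x • rightMul v p + y • rightMul w p := by
    ext <;> simp [rightMul_apply] <;> ring
  simp only [fieldDeriv, this, map_add, map_smul, Complex.real_smul]

/-- Moving `g₃(ψ)` to the right of a one-parameter subgroup turns its horizontal velocity by
the angle `-ψ`. -/
theorem rightDeriv_mul_gThree {k : ℤ} {F : SU2 → ℂ} (hF : F ∈ rightSpin k) {f : ℂ × ℂ → ℂ}
    (hf : ContDiff ℝ ∞ f) (hFf : ∀ g, F g = f (firstCol g)) {γ : ℝ → SU2} {w : ℂ}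
    (hγ : IsOneParam γ (0, w)) (g : SU2) (ψ : ℝ) :
    rightDeriv γ F (g * gThree ψ) =
      fieldDeriv (0, Complex.exp (-(ψ * I)) * w) f (firstCol g) *
        Complex.exp (I * ((k : ℂ) / 2) * ψ) := by
  have hinv : gThree (-ψ) * gThree ψ = 1 := by
    rw [← isOneParam_gThree.map_add, neg_add_cancel, isOneParam_gThree.map_zero]
  have hinv' : gThree ψ * gThree (-ψ) = 1 := by
    rw [← isOneParam_gThree.map_add, add_neg_cancel, isOneParam_gThree.map_zero]
  -- Write `g g₃(ψ) γ(t) = g (g₃(ψ) γ(t) g₃(-ψ)) g₃(ψ)`. The last factor gives the phase of `F`, the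
  -- bracket a curve through `1` with rotated velocity.
  have hδ : HasDerivAt (fun t => firstCol (gThree ψ * γ t * gThree (-ψ)))
      (0, Complex.exp (-(ψ * I)) * w) 0 := by
    have h := (rightMul (firstCol (gThree (-ψ)))).hasFDerivAt.comp_hasDerivAt (0 : ℝ)
      (hasDerivAt_rightMul hγ.hasDerivAt (firstCol (gThree ψ)))
    refine (h.congr_of_eventuallyEq (Filter.Eventually.of_forall fun t => ?_)).congr_deriv ?_
    · simp only [Function.comp, firstCol_mul]
    · simp only [gThree, firstCol_hSU2, rightMul_apply]
      have e1 : starRingEnd ℂ (cexp ((ψ / 2 : ℝ) * I)) = cexp (-((ψ / 2 : ℝ) * I)) := by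
        rw [← Complex.exp_conj]; simp [Complex.conj_ofNat]
      have e2 : cexp (-(ψ * I)) = cexp (-((ψ / 2 : ℝ) * I)) * cexp (((-ψ) / 2 : ℝ) * I) := by
        rw [← Complex.exp_add]; congr 1; push_cast; ring
      rw [e1, e2]
      ext <;> simp
      ring
  have h := hasDerivAt_comp_mul hf hFf hδ g
  have e : (fun t => F (g * gThree ψ * γ t)) = fun t =>
      F (g * (gThree ψ * γ t * gThree (-ψ))) * Complex.exp (I * ((k : ℂ) / 2) * ψ) := by
    funext t
    rw [← hF.2]
    simp only [mul_assoc, hinv, mul_one]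
  rw [rightDeriv, e, (h.mul_const _).deriv, hγ.map_zero, mul_one, hinv', mul_one]
  rfl

theorem rightDeriv_gOne_gTwo_mul_gThree {k : ℤ} {F : SU2 → ℂ} (hF : F ∈ rightSpin k) (g : SU2)
    (ψ : ℝ) :
    rightDeriv gOne F (g * gThree ψ) =
        (Complex.cos ψ * rightDeriv gOne F g + Complex.sin ψ * rightDeriv gTwo F g) *
          Complex.exp (I * ((k : ℂ) / 2) * ψ) ∧
      rightDeriv gTwo F (g * gThree ψ) =
        (Complex.cos ψ * rightDeriv gTwo F g - Complex.sin ψ * rightDeriv gOne F g) *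
          Complex.exp (I * ((k : ℂ) / 2) * ψ) := by
  obtain ⟨f, hf, hFf⟩ := hF.1
  rw [rightDeriv_mul_gThree hF hf hFf isOneParam_gOne,
    rightDeriv_mul_gThree hF hf hFf isOneParam_gTwo, rightDeriv_eq hf hFf isOneParam_gOne,
    rightDeriv_eq hf hFf isOneParam_gTwo]
  have e : cexp (-(ψ * I)) = Complex.cos ψ - Complex.sin ψ * I := by
    rw [← neg_mul, Complex.exp_mul_I]; simp [sub_eq_add_neg]
  have e1 : ((0, cexp (-(ψ * I)) * (I / 2)) : ℂ × ℂ) =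
      Real.cos ψ • (0, I / 2) + Real.sin ψ • (0, 1 / 2) := by
    rw [e]
    ext
    · simp
    · simp
      linear_combination (-Complex.sin ψ / 2) * Complex.I_mul_I
  have e2 : ((0, cexp (-(ψ * I)) * (1 / 2)) : ℂ × ℂ) =
      Real.cos ψ • (0, 1 / 2) + (-Real.sin ψ) • (0, I / 2) := by
    rw [e]
    ext
    · simp
    · simp
      ring
  rw [e1, e2, fieldDeriv_combination, fieldDeriv_combination]
  push_cast
  constructor <;> ring

/-- The rotation multiplies `X₂ + iX₁` by `exp (iψ)`. The index is twice the spin, so one unit of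
spin is `2`. -/
theorem eth_mem_rightSpin {k : ℤ} {F : SU2 → ℂ} (hF : F ∈ rightSpin k) :
    eth F ∈ rightSpin (k + 2) := by
  refine ⟨hF.1.eth, fun g ψ => ?_⟩
  obtain ⟨h1, h2⟩ := rightDeriv_gOne_gTwo_mul_gThree hF g ψ
  have e : cexp (I * (((k + 2 : ℤ) : ℂ) / 2) * ψ) =
      (Complex.cos ψ + Complex.sin ψ * I) * cexp (I * ((k : ℂ) / 2) * ψ) := by
    rw [← Complex.exp_mul_I, ← Complex.exp_add]; congr 1; push_cast; ring
  rw [eth_eq, e]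
  simp only [Pi.smul_apply, Pi.add_apply, smul_eq_mul, h1, h2]
  linear_combination Complex.sin ψ * rightDeriv gOne F g * cexp (I * ((k : ℂ) / 2) * ψ) *
    Complex.I_mul_I

theorem ethBar_mem_rightSpin {k : ℤ} {F : SU2 → ℂ} (hF : F ∈ rightSpin k) :
    ethBar F ∈ rightSpin (k - 2) := by
  refine ⟨hF.1.ethBar, fun g ψ => ?_⟩
  obtain ⟨h1, h2⟩ := rightDeriv_gOne_gTwo_mul_gThree hF g ψ
  have e : cexp (I * (((k - 2 : ℤ) : ℂ) / 2) * ψ) =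
      (Complex.cos ψ - Complex.sin ψ * I) * cexp (I * ((k : ℂ) / 2) * ψ) := by
    have h := Complex.exp_mul_I (-ψ)
    rw [Complex.cos_neg, Complex.sin_neg, neg_mul (Complex.sin _), ← sub_eq_add_neg] at h
    rw [← h, ← Complex.exp_add]
    congr 1; push_cast; ring
  rw [ethBar_eq, e]
  simp only [Pi.smul_apply, Pi.add_apply, smul_eq_mul, h1, h2]
  linear_combination Complex.sin ψ * rightDeriv gOne F g * cexp (I * ((k : ℂ) / 2) * ψ) *
    Complex.I_mul_I

/-! ### The metric in stereographic coordinates. -/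

theorem one_add_stereoRho_pos (u : Fin 3 → ℝ) : 0 < 1 + stereoRho u := by
  unfold stereoRho; positivity

/-- The partial derivatives of the first column of the stereographic parametrization
centred at `1`. -/
noncomputable def stereoDeriv (u : Fin 3 → ℝ) (i : Fin 3) : ℂ × ℂ :=
  let D := 1 + stereoRho u
  let e : Fin 3 → ℝ := Pi.single i 1
  (⟨-(u i / 4) / D ^ 2, (e 0 / 2 * D - u 0 / 2 * (u i / 8)) / D ^ 2⟩,
    ⟨(e 1 / 2 * D - u 1 / 2 * (u i / 8)) / D ^ 2, (e 2 / 2 * D - u 2 / 2 * (u i / 8)) / D ^ 2⟩)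

theorem hasDerivAt_stereoRho_line (u : Fin 3 → ℝ) (i : Fin 3) :
    HasDerivAt (fun t : ℝ => stereoRho (u + t • (Pi.single i 1 : Fin 3 → ℝ))) (u i / 8) 0 := by
  have h : ∀ j : Fin 3, HasDerivAt (fun t : ℝ => (u + t • (Pi.single i 1 : Fin 3 → ℝ)) j)
      ((Pi.single i 1 : Fin 3 → ℝ) j) 0 := fun j => by
    simpa using ((hasDerivAt_id (0 : ℝ)).mul_const ((Pi.single i 1 : Fin 3 → ℝ) j)).const_add (u j)
  have h' := ((((h 0).pow 2).add ((h 1).pow 2)).add ((h 2).pow 2)).div_const 16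
  refine h'.congr_deriv ?_
  fin_cases i <;> simp <;> ring

theorem HasDerivAt.complex_mk {x y : ℝ → ℝ} {x' y' t : ℝ} (hx : HasDerivAt x x' t)
    (hy : HasDerivAt y y' t) :
    HasDerivAt (fun s => (⟨x s, y s⟩ : ℂ)) ⟨x', y'⟩ t := by
  simp only [Complex.mk_eq_add_mul_I]
  exact hx.ofReal_comp.add (hy.ofReal_comp.mul_const I)

theorem hasDerivAt_firstCol_stereo (p : SU2) (u : Fin 3 → ℝ) (i : Fin 3) :
    HasDerivAt (fun t : ℝ => firstCol (stereo p (u + t • (Pi.single i 1 : Fin 3 → ℝ))))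
      (rightMul (stereoDeriv u i) (firstCol p)) 0 := by
  simp only [stereo, firstCol_mul, firstCol_hSU2]
  apply hasDerivAt_rightMul
  have hD : 1 + stereoRho u ≠ 0 := (one_add_stereoRho_pos u).ne'
  have hr := hasDerivAt_stereoRho_line u i
  have hD0 : 1 + stereoRho (u + (0 : ℝ) • (Pi.single i 1 : Fin 3 → ℝ)) ≠ 0 :=
    (one_add_stereoRho_pos _).ne'
  have h : ∀ j : Fin 3, HasDerivAt (fun t : ℝ => (u + t • (Pi.single i 1 : Fin 3 → ℝ)) j / 2 /
      (1 + stereoRho (u + t • (Pi.single i 1 : Fin 3 → ℝ))))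
      (((Pi.single i 1 : Fin 3 → ℝ) j / 2 * (1 + stereoRho u) - u j / 2 * (u i / 8)) /
        (1 + stereoRho u) ^ 2) 0 := fun j => by
    have h1 : HasDerivAt (fun t : ℝ => (u + t • (Pi.single i 1 : Fin 3 → ℝ)) j)
        ((Pi.single i 1 : Fin 3 → ℝ) j) 0 := by
      simpa using
        ((hasDerivAt_id (0 : ℝ)).mul_const ((Pi.single i 1 : Fin 3 → ℝ) j)).const_add (u j)
    simpa using (h1.div_const 2).fun_div (hr.const_add 1) hD0
  have h0 : HasDerivAt (fun t : ℝ => (1 - stereoRho (u + t • (Pi.single i 1 : Fin 3 → ℝ))) /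
      (1 + stereoRho (u + t • (Pi.single i 1 : Fin 3 → ℝ))))
      (-(u i / 4) / (1 + stereoRho u) ^ 2) 0 := by
    refine ((hr.const_sub 1).fun_div (hr.const_add 1) hD0).congr_deriv ?_
    simp only [zero_smul, add_zero]
    congr 1
    ring
  exact (h0.complex_mk (h 0)).prodMk ((h 1).complex_mk (h 2))

theorem coordVec_stereo (p : SU2) (u : Fin 3 → ℝ) (i : Fin 3) :
    coordVec (stereo p) i u = hMat (rightMul (stereoDeriv u i) (firstCol p)).1
      (rightMul (stereoDeriv u i) (firstCol p)).2 := by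
  have h := hasDerivAt_firstCol_stereo p u i
  have h0 := (ContinuousLinearMap.fst ℝ ℂ ℂ).hasFDerivAt.comp_hasDerivAt (0 : ℝ) h
  have h1 := (ContinuousLinearMap.snd ℝ ℂ ℂ).hasFDerivAt.comp_hasDerivAt (0 : ℝ) h
  have h0' := Complex.conjCLE.toContinuousLinearMap.hasFDerivAt.comp_hasDerivAt (0 : ℝ) h0
  have h1' := Complex.conjCLE.toContinuousLinearMap.hasFDerivAt.comp_hasDerivAt (0 : ℝ) h1
  ext a b
  fin_cases a <;> fin_cases b
  · exact h0.deriv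
  · change deriv _ 0 = _
    simp only [Fin.mk_one, Fin.zero_eta, SU2.apply_zero_one]
    exact h1'.neg.deriv
  · exact h1.deriv
  · change deriv _ 0 = _
    simp only [Fin.mk_one, SU2.apply_one_one]
    exact h0'.deriv

theorem metricH_hMat (a b c d : ℂ) : metricH (hMat a b) (hMat c d) =
    4 * (a.re * c.re + a.im * c.im + b.re * d.re + b.im * d.im) := by
  simp [metricH, hMat, Matrix.trace_fin_two, Matrix.mul_apply, Fin.sum_univ_two]
  ring

/-- `rightMul v (firstCol g)` is the quaternion product `g v`, so this is left invariance of the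
metric; it reduces the Gram matrix to the chart centred at `1`. -/
theorem metricH_rightMul (g : SU2) (v w : ℂ × ℂ) :
    metricH (hMat (rightMul v (firstCol g)).1 (rightMul v (firstCol g)).2)
      (hMat (rightMul w (firstCol g)).1 (rightMul w (firstCol g)).2) =
    metricH (hMat v.1 v.2) (hMat w.1 w.2) := by
  have h := normSq_firstCol g
  simp only [normSq_apply] at h
  simp only [metricH_hMat, rightMul_apply, firstCol]
  simp
  linear_combination (v.1.re * w.1.re + v.1.im * w.1.im + v.2.re * w.2.re + v.2.im * w.2.im) * h

theorem gram_stereo (p : SU2) (u : Fin 3 → ℝ) :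
    gram (stereo p) u = ((1 + stereoRho u) ^ 2)⁻¹ • (1 : Matrix (Fin 3) (Fin 3) ℝ) := by
  have hD : 1 + stereoRho u ≠ 0 := (one_add_stereoRho_pos u).ne'
  have hρ : stereoRho u = (u 0 ^ 2 + u 1 ^ 2 + u 2 ^ 2) / 16 := rfl
  ext i j
  simp only [gram, Matrix.of_apply, coordVec_stereo]
  rw [metricH_rightMul, metricH_hMat]
  simp only [stereoDeriv, Matrix.smul_apply, smul_eq_mul]
  generalize stereoRho u = r at *
  field_simp
  fin_cases i <;> fin_cases j <;> simp <;> rw [hρ] <;> ring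

theorem sqrt_det_gram_stereo (p : SU2) (u : Fin 3 → ℝ) :
    √(gram (stereo p) u).det = ((1 + stereoRho u) ^ 3)⁻¹ := by
  have hD := one_add_stereoRho_pos u
  rw [gram_stereo, Matrix.det_smul, Matrix.det_one, Fintype.card_fin, mul_one,
    show (((1 + stereoRho u) ^ 2)⁻¹) ^ 3 = (((1 + stereoRho u) ^ 3)⁻¹) ^ 2 by
      rw [inv_pow, inv_pow, ← pow_mul, ← pow_mul],
    Real.sqrt_sq (by positivity)]

/-- In dimension three the conformal powers are `-3` from the volume and `2` from the inverse
metric, leaving `-1`. -/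
theorem sqrt_det_mul_gram_inv_stereo (p : SU2) (u : Fin 3 → ℝ) (i j : Fin 3) :
    √(gram (stereo p) u).det * (gram (stereo p) u)⁻¹ i j =
      if i = j then (1 + stereoRho u)⁻¹ else 0 := by
  have hD := (one_add_stereoRho_pos u).ne'
  have hinv : (gram (stereo p) u)⁻¹ =
      (1 + stereoRho u) ^ 2 • (1 : Matrix (Fin 3) (Fin 3) ℝ) := by
    apply Matrix.inv_eq_right_inv
    rw [gram_stereo, Matrix.smul_mul, Matrix.mul_smul, smul_smul, mul_one,
      inv_mul_cancel₀ (pow_ne_zero 2 hD), one_smul]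
  rw [sqrt_det_gram_stereo, hinv, Matrix.smul_apply, Matrix.one_apply]
  split_ifs
  · simp; field_simp
  · simp

/-! ### The Laplace–Beltrami operator as a sum of squares. -/

theorem cos_two_mul_arctan (x : ℝ) : Real.cos (2 * Real.arctan x) = (1 - x ^ 2) / (1 + x ^ 2) := by
  have : 1 + x ^ 2 ≠ 0 := by positivity
  rw [Real.cos_two_mul, Real.cos_sq_arctan]
  field_simp
  ring

theorem sin_two_mul_arctan (x : ℝ) : Real.sin (2 * Real.arctan x) = 2 * x / (1 + x ^ 2) := by
  have h : 0 < 1 + x ^ 2 := by positivity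
  rw [Real.sin_two_mul, Real.sin_arctan, Real.cos_arctan]
  have := (Real.sqrt_pos.2 h).ne'
  field_simp
  rw [Real.sq_sqrt h.le]

/-- Each axis maps to a great circle through `p`. With `tan (t/4) = s/4`, the half-angle formulas
turn the stereographic fractions into `cos (t/2)` and `sin (t/2)`. -/
theorem stereo_axis (p : SU2) (s : ℝ) :
    stereo p (s • Pi.single 0 1) = p * gThree (4 * Real.arctan (s / 4)) ∧
    stereo p (s • Pi.single 1 1) = p * gTwo (4 * Real.arctan (s / 4)) ∧
    stereo p (s • Pi.single 2 1) = p * gOne (4 * Real.arctan (s / 4)) := by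
  have hs : 1 + (s / 4) ^ 2 ≠ 0 := by positivity
  have hs' : 1 + s ^ 2 / 16 ≠ 0 := by positivity
  have hρ : ∀ i, stereoRho (s • (Pi.single i 1 : Fin 3 → ℝ)) = s ^ 2 / 16 := fun i => by
    fin_cases i <;> simp [stereoRho]
  have e : 4 * Real.arctan (s / 4) / 2 = 2 * Real.arctan (s / 4) := by ring
  have hc : (1 - s ^ 2 / 16) / (1 + s ^ 2 / 16) = Real.cos (2 * Real.arctan (s / 4)) := by
    rw [cos_two_mul_arctan]; field_simp; norm_num; ring
  have hsn : s / 2 / (1 + s ^ 2 / 16) = Real.sin (2 * Real.arctan (s / 4)) := by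
    rw [sin_two_mul_arctan]; field_simp; norm_num; ring
  refine ⟨?_, ?_, ?_⟩ <;> unfold stereo <;> congr 1 <;> apply SU2.ext_firstCol <;>
    simp only [gOne, gTwo, gThree, firstCol_hSU2, e, Complex.exp_mul_I, ← ofReal_cos, ← ofReal_sin,
      hρ, Pi.smul_apply, Pi.single_apply, hc] <;>
    generalize Real.cos (2 * Real.arctan (s / 4)) = c <;>
    generalize Real.sin (2 * Real.arctan (s / 4)) = d at * <;>
    ext <;> apply Complex.ext <;> simp [hsn]

theorem hasDerivAt_four_mul_arctan (s : ℝ) :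
    HasDerivAt (fun s => 4 * Real.arctan (s / 4)) (1 + s ^ 2 / 16)⁻¹ s := by
  have h := (((hasDerivAt_id s).div_const 4).arctan).const_mul 4
  refine h.congr_deriv ?_
  have : 1 + s ^ 2 / 16 ≠ 0 := by positivity
  have : 1 + (s / 4) ^ 2 ≠ 0 := by positivity
  simp only [id]
  field_simp
  ring

/-- Only values on the `i`-th axis matter. There the inner derivative is `(1 + s²/16)⁻¹` times the
derivative of `F` along `γ`; both such weights are even in `s` and equal `1` at `0`, so they do not
affect the outer derivative. -/
theorem lineDeriv_lineDeriv_stereo {F : SU2 → ℂ} (hF : IsSmoothSU2 F) {γ : ℝ → SU2} {v : ℂ × ℂ}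
    (hγ : IsOneParam γ v) (p : SU2) (i : Fin 3)
    (hi : ∀ s : ℝ, stereo p (s • Pi.single i 1) = p * γ (4 * Real.arctan (s / 4))) :
    lineDeriv ℝ (fun w => (((1 + stereoRho w)⁻¹ : ℝ) : ℂ) *
      lineDeriv ℝ (fun v => F (stereo p v)) w (Pi.single i 1)) 0 (Pi.single i 1) =
      rightDeriv γ (rightDeriv γ F) p := by
  have hρ : ∀ s : ℝ, stereoRho (s • (Pi.single i 1 : Fin 3 → ℝ)) = s ^ 2 / 16 := fun s => by
    fin_cases i <;> simp [stereoRho]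
  have inner : ∀ s : ℝ, lineDeriv ℝ (fun v => F (stereo p v)) (s • Pi.single i 1) (Pi.single i 1) =
      (((1 + s ^ 2 / 16)⁻¹ : ℝ) : ℂ) * rightDeriv γ F (p * γ (4 * Real.arctan (s / 4))) := by
    intro s
    have h := (hF.hasDerivAt hγ p (4 * Real.arctan (s / 4))).scomp s (hasDerivAt_four_mul_arctan s)
    have h' : HasDerivAt ((fun t => F (p * γ t)) ∘ fun s => 4 * Real.arctan (s / 4))
        ((1 + s ^ 2 / 16)⁻¹ • rightDeriv γ F (p * γ (4 * Real.arctan (s / 4)))) (s + 0) := by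
      rw [add_zero]; exact h
    have h2 := h'.comp_const_add s 0
    rw [lineDeriv, ← Complex.real_smul, ← h2.deriv]
    congr 1
    funext t
    rw [← add_smul, hi]
    rfl
  simp only [lineDeriv, zero_add]
  simp only [lineDeriv] at inner
  simp only [hρ, inner]
  have hc : HasDerivAt (fun s : ℝ => (((1 + s ^ 2 / 16)⁻¹ : ℝ) : ℂ)) 0 0 := by
    have h := ((((hasDerivAt_id (0 : ℝ)).pow 2).div_const 16).const_add 1).inv (by simp)
    simpa using h.ofReal_comp
  have hX := ((hF.rightDeriv hγ).hasDerivAt hγ p (4 * Real.arctan (0 / 4))).scomp 0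
    (hasDerivAt_four_mul_arctan 0)
  refine (hc.fun_mul (hc.fun_mul hX)).deriv.trans ?_
  simp [hγ.map_zero]

theorem laplaceBeltrami_eq {F : SU2 → ℂ} (hF : IsSmoothSU2 F) :
    laplaceBeltrami F = rightDeriv gOne (rightDeriv gOne F) + rightDeriv gTwo (rightDeriv gTwo F) +
      rightDeriv gThree (rightDeriv gThree F) := by
  funext p
  have e3 := lineDeriv_lineDeriv_stereo hF isOneParam_gThree p 0 fun s => (stereo_axis p s).1
  have e2 := lineDeriv_lineDeriv_stereo hF isOneParam_gTwo p 1 fun s => (stereo_axis p s).2.1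
  have e1 := lineDeriv_lineDeriv_stereo hF isOneParam_gOne p 2 fun s => (stereo_axis p s).2.2
  have hz : ∀ v : Fin 3 → ℝ, lineDeriv ℝ (fun _ : Fin 3 → ℝ => (0 : ℂ)) 0 v = 0 := fun v => by
    simp [lineDeriv]
  have key : ∀ i j : Fin 3,
      lineDeriv ℝ (fun w => ((√(gram (stereo p) w).det * (gram (stereo p) w)⁻¹ i j : ℝ) : ℂ) *
        lineDeriv ℝ (fun v => F (stereo p v)) w (Pi.single j 1)) 0 (Pi.single i 1) =
      if i = j then lineDeriv ℝ (fun w => (((1 + stereoRho w)⁻¹ : ℝ) : ℂ) *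
        lineDeriv ℝ (fun v => F (stereo p v)) w (Pi.single j 1)) 0 (Pi.single i 1) else 0 := by
    intro i j
    split_ifs with h
    · congr 1
      funext w
      rw [sqrt_det_mul_gram_inv_stereo, if_pos h]
    · rw [← hz (Pi.single i 1)]
      congr 1
      funext w
      rw [sqrt_det_mul_gram_inv_stereo, if_neg h, ofReal_zero, zero_mul]
  rw [laplaceBeltrami, coordLaplacian,
    Finset.sum_congr rfl fun i _ => Finset.sum_congr rfl fun j _ => key i j, sqrt_det_gram_stereo]
  simp only [Finset.sum_ite_eq, Finset.mem_univ, if_true, Fin.sum_univ_three, e1, e2, e3]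
  simp [stereoRho]
  ring

/-! ### Coefficientwise calculus and the Wigner functions. -/

/-- `p'` is the derivative at `t` of the curve `p` of polynomials, coefficient by coefficient. -/
def HasCoeffDerivAt (p : ℝ → Polynomial ℂ) (p' : Polynomial ℂ) (t : ℝ) : Prop :=
  ∀ j, HasDerivAt (fun s => (p s).coeff j) (p'.coeff j) t

theorem HasCoeffDerivAt.mul {p q : ℝ → Polynomial ℂ} {p' q' : Polynomial ℂ} {t : ℝ}
    (hp : HasCoeffDerivAt p p' t) (hq : HasCoeffDerivAt q q' t) :
    HasCoeffDerivAt (fun s => p s * q s) (p' * q t + p t * q') t := fun j => by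
  simp only [Polynomial.coeff_add, Polynomial.coeff_mul, ← Finset.sum_add_distrib]
  exact HasDerivAt.fun_sum fun x _ => (hp x.1).fun_mul (hq x.2)

theorem HasCoeffDerivAt.pow {p : ℝ → Polynomial ℂ} {p' : Polynomial ℂ} {t : ℝ}
    (hp : HasCoeffDerivAt p p' t) (n : ℕ) :
    HasCoeffDerivAt (fun s => p s ^ n) (n * p t ^ (n - 1) * p') t := by
  induction n with
  | zero => intro j; simpa using hasDerivAt_const t _
  | succ n ih =>
    have h := ih.mul hp
    have e : (n : Polynomial ℂ) * p t ^ (n - 1) * p' * p t + p t ^ n * p' =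
        ((n + 1 : ℕ) : Polynomial ℂ) * p t ^ (n + 1 - 1) * p' := by
      cases n with
      | zero => simp
      | succ n => push_cast; ring
    rw [e] at h
    simpa only [pow_succ] using h

theorem hasCoeffDerivAt_linear {c d : ℝ → ℂ} {c' d' : ℂ} {t : ℝ} (hc : HasDerivAt c c' t)
    (hd : HasDerivAt d d' t) :
    HasCoeffDerivAt (fun s => Polynomial.C (c s) * Polynomial.X + Polynomial.C (d s))
      (Polynomial.C c' * Polynomial.X + Polynomial.C d') t := fun j => by
  rcases j with _ | _ | j
  · simpa using hd
  · simpa [Polynomial.coeff_C] using hc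
  · simpa [Polynomial.coeff_C, Polynomial.coeff_X] using hasDerivAt_const t (0 : ℂ)

/-- The coefficients of the family `p` of polynomials are smooth. -/
def ContDiffCoeff (p : ℂ × ℂ → Polynomial ℂ) : Prop :=
  ∀ j, ContDiff ℝ ∞ fun x => (p x).coeff j

theorem ContDiffCoeff.mul {p q : ℂ × ℂ → Polynomial ℂ} (hp : ContDiffCoeff p)
    (hq : ContDiffCoeff q) : ContDiffCoeff fun x => p x * q x := fun j => by
  simp only [Polynomial.coeff_mul]
  exact ContDiff.sum fun x _ => (hp x.1).mul (hq x.2)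

theorem ContDiffCoeff.pow {p : ℂ × ℂ → Polynomial ℂ} (hp : ContDiffCoeff p) (n : ℕ) :
    ContDiffCoeff fun x => p x ^ n := by
  induction n with
  | zero => intro j; simpa using contDiff_const
  | succ n ih => simpa only [pow_succ] using ih.mul hp

theorem contDiffCoeff_linear {c d : ℂ × ℂ → ℂ} (hc : ContDiff ℝ ∞ c) (hd : ContDiff ℝ ∞ d) :
    ContDiffCoeff fun x => Polynomial.C (c x) * Polynomial.X + Polynomial.C (d x) := fun j => by
  rcases j with _ | _ | j
  · simpa using hd
  · simpa [Polynomial.coeff_C] using hc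
  · simpa [Polynomial.coeff_C, Polynomial.coeff_X] using contDiff_const

/-- The first component `conj a * X + conj b` of `g⁻¹ z`, dehomogenized. -/
noncomputable def invFst (p : ℂ × ℂ) : Polynomial ℂ :=
  Polynomial.C (starRingEnd ℂ p.1) * Polynomial.X + Polynomial.C (starRingEnd ℂ p.2)

/-- The second component `-b * X + a` of `g⁻¹ z`, dehomogenized. -/
noncomputable def invSnd (p : ℂ × ℂ) : Polynomial ℂ :=
  Polynomial.C (-p.2) * Polynomial.X + Polynomial.C p.1

/-- The `j`-th coefficient of `(g⁻¹ z)₀ ^ k * (g⁻¹ z)₁ ^ m`. -/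
noncomputable def wignerCoeff (k m j : ℕ) (g : SU2) : ℂ :=
  (invFst (firstCol g) ^ k * invSnd (firstCol g) ^ m).coeff j

theorem wignerD_eq (N j k : ℕ) : wignerD N j k =
    ((Real.sqrt (N.choose k) : ℝ) / (Real.sqrt (N.choose j) : ℝ) : ℂ) • wignerCoeff k (N - k) j :=
  rfl

theorem isSmoothSU2_wignerCoeff (k m j : ℕ) : IsSmoothSU2 (wignerCoeff k m j) := by
  have h1 : ContDiffCoeff invFst := contDiffCoeff_linear
    (Complex.conjCLE.contDiff.comp contDiff_fst) (Complex.conjCLE.contDiff.comp contDiff_snd)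
  have h2 : ContDiffCoeff invSnd := contDiffCoeff_linear contDiff_snd.neg contDiff_fst
  exact ⟨_, (h1.pow k).mul (h2.pow m) j, fun g => rfl⟩

/-- Right multiplication by `g₃(ψ)` scales `invFst` by `exp (-iψ/2)` and `invSnd` by `exp (iψ/2)`.
-/
theorem wignerCoeff_mul_gThree (k m j : ℕ) (g : SU2) (ψ : ℝ) :
    wignerCoeff k m j (g * gThree ψ) =
      wignerCoeff k m j g * cexp (I * (((m : ℂ) - k) / 2) * ψ) := by
  have e1 : starRingEnd ℂ (cexp ((ψ / 2 : ℝ) * I)) = cexp (-((ψ / 2 : ℝ) * I)) := by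
    rw [← Complex.exp_conj]; simp [Complex.conj_ofNat]
  have h1 : invFst (firstCol (g * gThree ψ)) =
      Polynomial.C (cexp (-((ψ / 2 : ℝ) * I))) * invFst (firstCol g) := by
    simp only [firstCol_mul, gThree, firstCol_hSU2, rightMul_apply, invFst, mul_zero, sub_zero,
      add_zero, map_mul, e1]
    ring
  have h2 : invSnd (firstCol (g * gThree ψ)) =
      Polynomial.C (cexp ((ψ / 2 : ℝ) * I)) * invSnd (firstCol g) := by
    simp only [firstCol_mul, gThree, firstCol_hSU2, rightMul_apply, invSnd, mul_zero, sub_zero,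
      add_zero, map_mul, map_neg]
    ring
  have e : cexp (I * (((m : ℂ) - k) / 2) * ψ) =
      cexp (-((ψ / 2 : ℝ) * I)) ^ k * cexp ((ψ / 2 : ℝ) * I) ^ m := by
    rw [← Complex.exp_nat_mul, ← Complex.exp_nat_mul, ← Complex.exp_add]
    congr 1
    push_cast
    ring
  rw [wignerCoeff, h1, h2, mul_pow, mul_pow, mul_mul_mul_comm, ← Polynomial.C_pow,
    ← Polynomial.C_pow, ← Polynomial.C_mul, Polynomial.coeff_C_mul, e, mul_comm]
  rfl

/-- A horizontal velocity exchanges the two linear forms, `u' = w̄ v` and `v' = -w u`; the rest is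
the Leibniz rule. The truncated exponents `k - 1`, `m - 1` are harmless, as their factors `k`, `m`
then vanish. -/
theorem rightDeriv_wignerCoeff (k m j : ℕ) {γ : ℝ → SU2} {w : ℂ} (hγ : IsOneParam γ (0, w))
    (g : SU2) :
    rightDeriv γ (wignerCoeff k m j) g =
      starRingEnd ℂ w * (k * wignerCoeff (k - 1) (m + 1) j g) -
        w * (m * wignerCoeff (k + 1) (m - 1) j g) := by
  set p := firstCol g with hp
  have h := hasDerivAt_rightMul hγ.hasDerivAt p
  have ha := (ContinuousLinearMap.fst ℝ ℂ ℂ).hasFDerivAt.comp_hasDerivAt (0 : ℝ) h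
  have hb := (ContinuousLinearMap.snd ℝ ℂ ℂ).hasFDerivAt.comp_hasDerivAt (0 : ℝ) h
  have ha' := Complex.conjCLE.toContinuousLinearMap.hasFDerivAt.comp_hasDerivAt (0 : ℝ) ha
  have hb' := Complex.conjCLE.toContinuousLinearMap.hasFDerivAt.comp_hasDerivAt (0 : ℝ) hb
  have d1 : Polynomial.C (starRingEnd ℂ (rightMul (0, w) p).1) * Polynomial.X +
      Polynomial.C (starRingEnd ℂ (rightMul (0, w) p).2) =
      Polynomial.C (starRingEnd ℂ w) * invSnd p := by
    simp [rightMul_apply, invSnd]; ring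
  have d2 : Polynomial.C (-(rightMul (0, w) p).2) * Polynomial.X +
      Polynomial.C (rightMul (0, w) p).1 = -(Polynomial.C w * invFst p) := by
    simp [rightMul_apply, invFst]; ring
  have h1 : HasCoeffDerivAt (fun s => invFst (rightMul (firstCol (γ s)) p))
      (Polynomial.C (starRingEnd ℂ w) * invSnd p) 0 := by
    rw [← d1]; exact hasCoeffDerivAt_linear ha' hb'
  have h2 : HasCoeffDerivAt (fun s => invSnd (rightMul (firstCol (γ s)) p))
      (-(Polynomial.C w * invFst p)) 0 := by
    rw [← d2]; exact hasCoeffDerivAt_linear hb.neg ha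
  have e0 : rightMul (firstCol (γ 0)) p = p := by rw [hp, ← firstCol_mul, hγ.map_zero, mul_one]
  have h3 := ((h1.pow k).mul (h2.pow m) j).deriv
  rw [e0] at h3
  simp only [rightDeriv, wignerCoeff, firstCol_mul, ← hp]
  refine h3.trans ?_
  have e3 : (k * invFst p ^ (k - 1) * (Polynomial.C (starRingEnd ℂ w) * invSnd p)) * invSnd p ^ m +
      invFst p ^ k * (m * invSnd p ^ (m - 1) * -(Polynomial.C w * invFst p)) =
      Polynomial.C (starRingEnd ℂ w * k) * (invFst p ^ (k - 1) * invSnd p ^ (m + 1)) -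
      Polynomial.C (w * m) * (invFst p ^ (k + 1) * invSnd p ^ (m - 1)) := by
    simp only [map_mul, map_natCast]
    ring
  rw [e3, Polynomial.coeff_sub, Polynomial.coeff_C_mul, Polynomial.coeff_C_mul, mul_assoc,
    mul_assoc]

theorem eth_wignerCoeff (k m j : ℕ) :
    eth (wignerCoeff k m j) = (-(k : ℂ)) • wignerCoeff (k - 1) (m + 1) j := by
  funext g
  rw [eth_eq]
  simp only [Pi.smul_apply, Pi.add_apply, smul_eq_mul, rightDeriv_wignerCoeff k m j isOneParam_gOne,
    rightDeriv_wignerCoeff k m j isOneParam_gTwo]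
  simp [Complex.conj_ofNat]
  linear_combination (k * wignerCoeff (k - 1) (m + 1) j g / 2 +
    m * wignerCoeff (k + 1) (m - 1) j g / 2) * Complex.I_mul_I

theorem ethBar_wignerCoeff (k m j : ℕ) :
    ethBar (wignerCoeff k m j) = (m : ℂ) • wignerCoeff (k + 1) (m - 1) j := by
  funext g
  rw [ethBar_eq]
  simp only [Pi.smul_apply, Pi.add_apply, smul_eq_mul, rightDeriv_wignerCoeff k m j isOneParam_gOne,
    rightDeriv_wignerCoeff k m j isOneParam_gTwo]
  simp [Complex.conj_ofNat]
  linear_combination (-(k * wignerCoeff (k - 1) (m + 1) j g / 2) -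
    m * wignerCoeff (k + 1) (m - 1) j g / 2) * Complex.I_mul_I

theorem eth_add {F G : SU2 → ℂ} (hF : IsSmoothSU2 F) (hG : IsSmoothSU2 G) :
    eth (F + G) = eth F + eth G := by
  simp only [eth_eq, rightDeriv_add hF hG isOneParam_gOne, rightDeriv_add hF hG isOneParam_gTwo]
  module

theorem ethBar_add {F G : SU2 → ℂ} (hF : IsSmoothSU2 F) (hG : IsSmoothSU2 G) :
    ethBar (F + G) = ethBar F + ethBar G := by
  simp only [ethBar_eq, rightDeriv_add hF hG isOneParam_gOne, rightDeriv_add hF hG isOneParam_gTwo]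
  module

theorem eth_smul {F : SU2 → ℂ} (hF : IsSmoothSU2 F) (c : ℂ) : eth (c • F) = c • eth F := by
  simp only [eth_eq, rightDeriv_smul hF c isOneParam_gOne, rightDeriv_smul hF c isOneParam_gTwo]
  module

theorem ethBar_smul {F : SU2 → ℂ} (hF : IsSmoothSU2 F) (c : ℂ) :
    ethBar (c • F) = c • ethBar F := by
  simp only [ethBar_eq, rightDeriv_smul hF c isOneParam_gOne, rightDeriv_smul hF c isOneParam_gTwo]
  module

theorem eth_ethBar_wignerCoeff (k m j : ℕ) :
    eth (ethBar (wignerCoeff k m j)) = (-((m : ℂ) * (k + 1))) • wignerCoeff k m j := by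
  rw [ethBar_wignerCoeff, eth_smul (isSmoothSU2_wignerCoeff _ _ _), eth_wignerCoeff, smul_smul]
  -- For `m = 0` the index `m - 1 + 1` is not `m`, but the coefficient is zero.
  rcases m with _ | m
  · simp
  · rw [Nat.add_sub_cancel, Nat.add_sub_cancel]
    congr 1
    push_cast
    ring

/-- Both claims are linear in `F` and pass from generators to the span. They are proved jointly
since additivity of `ð` and `ð̄` uses the smoothness contained in `rightSpin`. -/
theorem mem_rightSpin_of_mem_wignerColumn {N k : ℕ} (hk : k ≤ N) {F : SU2 → ℂ}
    (hF : F ∈ wignerColumn N k) :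
    F ∈ rightSpin ((N : ℤ) - 2 * k) ∧
      eth (ethBar F) = (-(((N : ℂ) - k) * (k + 1))) • F := by
  induction hF using Submodule.span_induction with
  | mem F h =>
    obtain ⟨j, -, rfl⟩ := h
    have hs := isSmoothSU2_wignerCoeff k (N - k) j
    rw [wignerD_eq]
    refine ⟨⟨hs.smul _, fun g ψ => ?_⟩, ?_⟩
    · simp only [Pi.smul_apply, smul_eq_mul, wignerCoeff_mul_gThree]
      rw [show ((N - k : ℕ) : ℂ) - k = (((N : ℤ) - 2 * k : ℤ) : ℂ) by push_cast [hk]; ring,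
        mul_assoc, mul_assoc]
    · rw [ethBar_smul hs, eth_smul hs.ethBar, eth_ethBar_wignerCoeff, Nat.cast_sub hk, smul_comm]
  | zero =>
    have hs : IsSmoothSU2 0 := ⟨0, contDiff_const, fun _ => rfl⟩
    refine ⟨⟨hs, fun g ψ => by simp⟩, ?_⟩
    have h1 := ethBar_smul hs 0
    have h2 := eth_smul hs 0
    simp only [zero_smul] at h1 h2
    rw [h1, h2, smul_zero]
  | add F G _ _ hF hG =>
    refine ⟨⟨hF.1.1.add hG.1.1, fun g ψ => ?_⟩, ?_⟩
    · simp only [Pi.add_apply, hF.1.2, hG.1.2, add_mul]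
    · rw [ethBar_add hF.1.1 hG.1.1, eth_add hF.1.1.ethBar hG.1.1.ethBar, hF.2, hG.2, smul_add]
  | smul c F _ hF =>
    refine ⟨⟨hF.1.1.smul c, fun g ψ => ?_⟩, ?_⟩
    · simp only [Pi.smul_apply, smul_eq_mul, hF.1.2, mul_assoc]
    · rw [ethBar_smul hF.1.1, eth_smul hF.1.1.ethBar, hF.2, smul_comm]

/-! ### Assembly. -/

theorem IsSmoothSU2.vertLaplacian {F : SU2 → ℂ} (hF : IsSmoothSU2 F) :
    IsSmoothSU2 (vertLaplacian F) := by
  rw [vertLaplacian_eq hF]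
  exact (hF.rightDeriv isOneParam_gThree).rightDeriv isOneParam_gThree

theorem IsSmoothSU2.laplaceBeltrami {F : SU2 → ℂ} (hF : IsSmoothSU2 F) :
    IsSmoothSU2 (laplaceBeltrami F) := by
  rw [laplaceBeltrami_eq hF]
  exact (((hF.rightDeriv isOneParam_gOne).rightDeriv isOneParam_gOne).add
    ((hF.rightDeriv isOneParam_gTwo).rightDeriv isOneParam_gTwo)).add
    ((hF.rightDeriv isOneParam_gThree).rightDeriv isOneParam_gThree)

theorem laplaceBeltrami_eq_eth_ethBar {F : SU2 → ℂ} (hF : IsSmoothSU2 F) (g : SU2) :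
    laplaceBeltrami F g = eth (ethBar F) g + vertLaplacian F g + spinOp F g := by
  rw [laplaceBeltrami_eq hF, vertLaplacian_eq hF]
  simp only [Pi.add_apply]
  linear_combination -eth_ethBar_add_spinOp hF g

/-- `Q` acts on `F` as a scalar, so `Q² = -d²/dψ²` acts as its square. -/
theorem vertLaplacian_of_mem_rightSpin {k : ℤ} {F : SU2 → ℂ} (hF : F ∈ rightSpin k) (g : SU2) :
    vertLaplacian F g = -((k : ℂ) / 2) ^ 2 * F g := by
  have e : spinOp F = ((k : ℂ) / 2) • F := funext fun g => spinOp_of_mem_rightSpin hF g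
  have h := spinOp_spinOp hF.1 g
  rw [e, spinOp_eq, rightDeriv_smul hF.1 _ isOneParam_gThree, smul_comm, ← spinOp_eq, e] at h
  simp only [Pi.smul_apply, smul_eq_mul] at h
  linear_combination h

theorem mainTheorem11 :
    -- the operators act on smooth functions, and `ð`, `ð̄` raise and lower the right spin
    (∀ F : SU2 → ℂ, IsSmoothSU2 F →
      IsSmoothSU2 (eth F) ∧ IsSmoothSU2 (ethBar F) ∧ IsSmoothSU2 (spinOp F) ∧
      IsSmoothSU2 (vertLaplacian F) ∧ IsSmoothSU2 (laplaceBeltrami F)) ∧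
    (∀ k : ℤ, ∀ F ∈ rightSpin k, eth F ∈ rightSpin (k + 2) ∧ ethBar F ∈ rightSpin (k - 2)) ∧
    -- `-i d/dψ` is the signed square root of `-d²/dψ²`: it acts on `R(n)` as `n`
    (∀ F : SU2 → ℂ, IsSmoothSU2 F → ∀ g : SU2, spinOp (spinOp F) g = -vertLaplacian F g) ∧
    (∀ k : ℤ, ∀ F ∈ rightSpin k, ∀ g : SU2, spinOp F g = ((k : ℂ) / 2) * F g) ∧
    -- the decomposition of the Laplace–Beltrami operator and of the horizontal Laplacian
    (∀ F : SU2 → ℂ, IsSmoothSU2 F → ∀ g : SU2,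
      laplaceBeltrami F g = eth (ethBar F) g + vertLaplacian F g + spinOp F g) ∧
    (∀ F : SU2 → ℂ, IsSmoothSU2 F → ∀ g : SU2,
      horLaplacian F g = eth (ethBar F) g + spinOp F g) ∧
    -- the eigenvalues on the column spaces of the Wigner matrices, `ℓ = N / 2`, `s = k - ℓ`
    (∀ (N k : ℕ), k ≤ N → ∀ (l s : ℂ), l = (N : ℂ) / 2 → s = (k : ℂ) - (N : ℂ) / 2 →
      ∀ F ∈ wignerColumn N k,
        F ∈ rightSpin ((N : ℤ) - 2 * k) ∧
        ∀ g : SU2,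
          laplaceBeltrami F g = -(l * (l + 1)) * F g ∧
          vertLaplacian F g = -s ^ 2 * F g ∧
          horLaplacian F g = (-((l - s) * (l + s + 1)) - s) * F g ∧
          eth (ethBar F) g = -((l - s) * (l + s + 1)) * F g ∧
          spinOp F g = -s * F g) := by
  have hor : ∀ F : SU2 → ℂ, IsSmoothSU2 F → ∀ g : SU2,
      horLaplacian F g = eth (ethBar F) g + spinOp F g := fun F hF g => by
    rw [horLaplacian, laplaceBeltrami_eq_eth_ethBar hF]
    ring
  refine ⟨fun F hF => ⟨hF.eth, hF.ethBar, hF.spinOp, hF.vertLaplacian, hF.laplaceBeltrami⟩,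
    fun k F hF => ⟨eth_mem_rightSpin hF, ethBar_mem_rightSpin hF⟩,
    fun F hF g => spinOp_spinOp hF g, fun k F hF g => spinOp_of_mem_rightSpin hF g,
    fun F hF g => laplaceBeltrami_eq_eth_ethBar hF g, hor, ?_⟩
  rintro N k hk l s rfl rfl F hF
  obtain ⟨hR, hE⟩ := mem_rightSpin_of_mem_wignerColumn hk hF
  refine ⟨hR, fun g => ?_⟩
  have hv := vertLaplacian_of_mem_rightSpin hR g
  have hq := spinOp_of_mem_rightSpin hR g
  have he := congrFun hE g
  simp only [Pi.smul_apply, smul_eq_mul] at he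
  push_cast at hv hq
  rw [laplaceBeltrami_eq_eth_ethBar hR.1, hor F hR.1, hv, hq, he]
  -- The first goal is the identity `(ℓ-s)(ℓ+s+1) + s² + s = ℓ(ℓ+1)`.
  refine ⟨?_, ?_, ?_, ?_, ?_⟩ <;> ring
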